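/- **Formulas** are $A ::= 1 \mid \bot \mid A\otimes A \mid A ⅋ A \mid {!}A \mid {?}A$, with the usual De Morgan duality $A^\perp$; positive formulas are $P ::= 1 \mid P\otimes P$. **Nets.** A *pre-net* is a finite well-typed graph: each edge carries a formula, is a conclusion of exactly one node and a premise of at most one node; edges that are premises of no node are the conclusions of the pre-net. The nodes are: axiom (conclusions $A, A^\perp$), cut (premises $A, A^\perp$), $\mathsf{one}$ (conclusion $1$), $\otimes$, $⅋$, dereliction (premise $A$, conclusion ${?}A$), weakening (conclusion ${?}A$), contraction (premises ${?}A,{?}A$, conclusion ${?}A$), *sync nodes* (premises $P_1,\dots,P_n$ and conclusions $P_1,\dots,P_n$, all positive, $n\ge 0$; the arity is the total number of $1$'s in the $P_i$), and boxes: a $\bot$-box with conclusions $\bot,\Gamma$ ($\Gamma\neq\emptyset$), containing a left and a right pre-net of conclusions $\Gamma$; a $!$-box with conclusions ${!}A,{?}\Gamma$, containing a pre-net of conclusions $A,{?}\Gamma$; a $Y$-box with conclusions ${!}A,{?}\Gamma$, containing a pre-net of conclusions $A,{?}A^\perp,{?}\Gamma$. A *switching path* is an undirected path which uses at most one premise of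 each $⅋$ and contraction node and at most one conclusion of each sync node. A *net* is a pre-net in which no switching path is cyclic, the pre-nets in its boxes being themselves correct, and in which each sync node (at any depth) has a name in a finite set $\mathcal L$. **Memory structures.** A memory structure consists of a countably infinite set $I$ of addresses, a nominal set $\mathcal M$ (a set with an action of the finitary permutations of $I$, all of whose elements have finite support), a finite set $\mathcal L$ of operations with arities, a map $\mathrm{test}: I\times \mathcal M\to \mathcal D(\mathrm{Bool}\times \mathcal M)$ and a partial map $\mathrm{update}: I^*\times\mathcal L\times\mathcal M\rightharpoonup\mathcal M$. Here $\mathcal D(X)$ is the set of functions $X\to[0,1]$ of total mass at most $1$. Both maps are equivariant, $\mathrm{update}(\vec i,x,m)$ is defined iff the entries of $\vec i$ are pairwise distinct and their number is the arity of $x$, and tests and updates on disjoint addresses commute. **Program nets.** A *raw program net* is a triple $(R,\mathrm{ind},m)$ with $R$ a net such that the arity of each sync node is that of its name, $m\in\mathcal M$, and $\mathrm{ind}$ an injective partial map to $I$ from the set of the conclusions of the $\mathsf{one}$ nodes at the surface of $R$ together with the occurrences of $\bot$ in the conclusions of $R$, total on the latter. A $\mathsf{one}$ node is active if $\mathrm{ind}$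 is defined on it. A *program net* $[(R,\mathrm{ind},m)]$ is an equivalence class of raw program nets under finitary permutations of $I$ acting on $\mathrm{ind}$ and $m$. **Reduction** applies to the surface (depth $0$) only and is given by the following rules, read on equivalence classes. (Link) An inactive $\mathsf{one}$ node is given an address fresh for $\mathrm{ind}$ and $m$. (Update) A sync node named $l$ all of whose premises are conclusions of active $\mathsf{one}$ nodes, with addresses $\vec i$, is erased (the $\mathsf{one}$ nodes and their addresses passing to its conclusions), and $m$ becomes $\mathrm{update}(\vec i,l,m)$. (Test) If an active $\mathsf{one}$ node of address $i$ is cut against the principal conclusion of a $\bot$-box, the redex is replaced by the left content on outcome false, and by the right content on outcome true, of $\mathrm{test}(i,m)$, which also gives the new memory; the result is the corresponding distribution. (Net rules, not acting on the memory) A cut against an axiom is erased; a cut of $A\otimes B$ against $A^\perp ⅋ B^\perp$ introduced by a $\otimes$ and a $⅋$ node is replaced by cuts on $A$ and $B$; a sync node with a premise $P\otimes Q$ that is the conclusion of a $\otimes$ node is replaced by a sync node with premises $P,Q$ followed by the $\otimes$ node; and, for a closed $!$- or $Y$-box (one without auxiliary conclusions) whose conclusion ${!}A$ is cut against ${?}A^\perp$: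 a dereliction opens a $!$-box, and unfolds a $Y$-box once (its content is opened, and the conclusion ${?}A^\perp$ of the content is cut against a copy of the $Y$-box); a weakening erases the box; a contraction duplicates it; an auxiliary conclusion of another $!$- or $Y$-box lets the closed box enter that box. **Theorem (Deadlock-freeness of net reduction, and cut elimination).** Let $\mathbf R=[(R,\mathrm{ind},m)]$ be a program net such that no $\bot$, $?$ or $!$ appears in (the types of) the conclusions of $R$. 1. If $R$ contains a cut (at any depth), then a reduction step is possible: there is $\mu$ with $\mathbf R\rightsquigarrow\mu$. 2. Consequently, if $\mathbf R\not\rightsquigarrow$ (no reduction is possible), then $R$ contains no cut. -/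

import Mathlib

open scoped ENNReal

namespace SMEYLL

universe u v w

/-! ### Formulas -/

/-- Formulas of constant-only multiplicative exponential linear logic. -/
inductive Formula : Type
  | one : Formula
  | bot : Formula
  | tensor : Formula → Formula → Formula
  | par : Formula → Formula → Formula
  | bang : Formula → Formula
  | quest : Formula → Formula

namespace Formula

/-- Linear negation. -/
def dual : Formula → Formula
  | one => bot
  | bot => one
  | tensor A B => par A.dual B.dual
  | par A B => tensor A.dual B.dual
  | bang A => quest A.dual
  | quest A => bang A.dual

/-- Positive formulas `P ::= 1 | P ⊗ P`. -/
def IsPositive : Formula → Prop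
  | one => True
  | tensor A B => A.IsPositive ∧ B.IsPositive
  | _ => False

/-- The number of occurrences of the unit `1`. -/
def countOne : Formula → ℕ
  | one => 1
  | bot => 0
  | tensor A B => A.countOne + B.countOne
  | par A B => A.countOne + B.countOne
  | bang A => A.countOne
  | quest A => A.countOne

/-- None of the symbols `⊥`, `!`, `?` appears in the formula. -/
def NoBotExp : Formula → Prop
  | one => True
  | bot => False
  | tensor A B => A.NoBotExp ∧ B.NoBotExp
  | par A B => A.NoBotExp ∧ B.NoBotExp
  | bang _ => False
  | quest _ => False

/-- The subformula occurrence reached from the root by following a path: at a binary connective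
`false` is left and `true` is right; a modality is crossed by `false`. -/
def subAt : Formula → List Bool → Option Formula
  | A, [] => some A
  | tensor A _, false :: p => A.subAt p
  | tensor _ B, true :: p => B.subAt p
  | par A _, false :: p => A.subAt p
  | par _ B, true :: p => B.subAt p
  | bang A, false :: p => A.subAt p
  | quest A, false :: p => A.subAt p
  | _, _ :: _ => none

end Formula

/-! ### Pre-nets

A pre-net is a finite graph, given by the list of its nodes.  Edges are named by natural numbers;
every node lists the edges which are its premises and its conclusions, with their types.  The
content of a box has its own, separate, edge names; each door of a box matches an edge inside
(a conclusion of the content) with an edge outside (a conclusion of the box). -/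

/-- The `k`-th premise and `k`-th conclusion of a sync node, with their common type. -/
structure SyncPort : Type where
  ty : Formula
  prem : ℕ
  concl : ℕ

/-- An auxiliary door of an exponential box: the edges `inner` and `outer` have type `?ty`. -/
structure ExpDoor : Type where
  ty : Formula
  inner : ℕ
  outer : ℕ

/-- An auxiliary door of a `⊥`-box: the edge `left` of the left content, the edge `right` of the
right content and the conclusion `outer` of the box have type `ty`. -/
structure BotDoor : Type where
  ty : Formula
  left : ℕ
  right : ℕ
  outer : ℕ

/-- Nodes. -/
inductive Cell (Op : Type u) : Type u
  /-- axiom: conclusions `e : A`, `f : A^⊥` -/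
  | ax (A : Formula) (e f : ℕ)
  /-- cut: premises `e : A`, `f : A^⊥` -/
  | cut (A : Formula) (e f : ℕ)
  /-- conclusion `e : 1` -/
  | one (e : ℕ)
  /-- premises `e : A`, `f : B`, conclusion `g : A ⊗ B` -/
  | tensor (A B : Formula) (e f g : ℕ)
  /-- premises `e : A`, `f : B`, conclusion `g : A ⅋ B` -/
  | par (A B : Formula) (e f g : ℕ)
  /-- dereliction: premise `e : A`, conclusion `f : ?A` -/
  | der (A : Formula) (e f : ℕ)
  /-- weakening: conclusion `e : ?A` -/
  | weak (A : Formula) (e : ℕ)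
  /-- contraction: premises `e f : ?A`, conclusion `g : ?A` -/
  | contr (A : Formula) (e f g : ℕ)
  /-- sync node named `l` -/
  | sync (l : Op) (ps : List SyncPort)
  /-- `⊥`-box with principal conclusion `e : ⊥`; the left and right contents are
  `(bot, S₀)` and `(bot, S₁)`, where `bot` is the node with single conclusion `⊥` -/
  | botBox (e : ℕ) (ds : List BotDoor) (S₀ S₁ : List (Cell Op))
  /-- exponential box with principal conclusion `e : !A`, whose principal door has premise `a : A`.
  It is a `!`-box if `y = none`, and a `Y`-box if `y = some r`, where `r : ?A^⊥` is the further
  conclusion of its content. -/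
  | expBox (y : Option ℕ) (A : Formula) (a e : ℕ) (ds : List ExpDoor) (S : List (Cell Op))

/-- A pre-net, not yet subject to the typing conditions. -/
abbrev Net (Op : Type u) := List (Cell Op)

variable {Op : Type u}

namespace Cell

/-- The conclusions of a node, with their types. -/
def concls : Cell Op → List (ℕ × Formula)
  | ax A e f => [(e, A), (f, A.dual)]
  | cut _ _ _ => []
  | one e => [(e, .one)]
  | tensor A B _ _ g => [(g, .tensor A B)]
  | par A B _ _ g => [(g, .par A B)]
  | der A _ f => [(f, .quest A)]
  | weak A e => [(e, .quest A)]
  | contr A _ _ g => [(g, .quest A)]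
  | sync _ ps => ps.map fun p => (p.concl, p.ty)
  | botBox e ds _ _ => (e, .bot) :: ds.map fun d => (d.outer, d.ty)
  | expBox _ A _ e ds _ => (e, .bang A) :: ds.map fun d => (d.outer, .quest d.ty)

/-- The premises of a node, with their types. -/
def prems : Cell Op → List (ℕ × Formula)
  | ax _ _ _ => []
  | cut A e f => [(e, A), (f, A.dual)]
  | one _ => []
  | tensor A B e f _ => [(e, A), (f, B)]
  | par A B e f _ => [(e, A), (f, B)]
  | der A e _ => [(e, A)]
  | weak _ _ => []
  | contr A e f _ => [(e, .quest A), (f, .quest A)]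
  | sync _ ps => ps.map fun p => (p.prem, p.ty)
  | botBox _ _ _ _ => []
  | expBox _ _ _ _ _ _ => []

/-- The names of the edges which are conclusions of a node. -/
def conclEdges (c : Cell Op) : List ℕ := c.concls.map Prod.fst

/-- The names of the edges which are premises of a node. -/
def premEdges (c : Cell Op) : List ℕ := c.prems.map Prod.fst

/-- The pre-nets associated to a node: none unless it is a box. -/
def contents : Cell Op → List (Net Op)
  | botBox _ _ S₀ S₁ => [S₀, S₁]
  | expBox _ _ _ _ _ S => [S]
  | _ => []

/-- Renaming of the premises and conclusions of a node (the inside of boxes is untouched). -/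
def rename (ρ : ℕ → ℕ) : Cell Op → Cell Op
  | ax A e f => ax A (ρ e) (ρ f)
  | cut A e f => cut A (ρ e) (ρ f)
  | one e => one (ρ e)
  | tensor A B e f g => tensor A B (ρ e) (ρ f) (ρ g)
  | par A B e f g => par A B (ρ e) (ρ f) (ρ g)
  | der A e f => der A (ρ e) (ρ f)
  | weak A e => weak A (ρ e)
  | contr A e f g => contr A (ρ e) (ρ f) (ρ g)
  | sync l ps => sync l (ps.map fun p => ⟨p.ty, ρ p.prem, ρ p.concl⟩)
  | botBox e ds S₀ S₁ => botBox (ρ e) (ds.map fun d => ⟨d.ty, d.left, d.right, ρ d.outer⟩) S₀ S₁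
  | expBox y A a e ds S => expBox y A a (ρ e) (ds.map fun d => ⟨d.ty, d.inner, ρ d.outer⟩) S

/-- The node is an axiom with conclusions `e : A` and `f : A^⊥`, read in either order. -/
def IsAx (c : Cell Op) (A : Formula) (e f : ℕ) : Prop := c = ax A e f ∨ c = ax A.dual f e

/-- The node is a cut with premises `e : A` and `f : A^⊥`, read in either order. -/
def IsCut (c : Cell Op) (A : Formula) (e f : ℕ) : Prop := c = cut A e f ∨ c = cut A.dual f e

/-- `⅋` and `?c` nodes. -/
def IsParOrContr : Cell Op → Prop
  | par _ _ _ _ _ => True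
  | contr _ _ _ _ => True
  | _ => False

/-- Sync nodes. -/
def IsSync : Cell Op → Prop
  | sync _ _ => True
  | _ => False

end Cell

namespace Net

/-- Names of the edges of a net (every edge is a conclusion of some node). -/
def edges (R : Net Op) : List ℕ := R.flatMap Cell.conclEdges

/-- Names of the edges which are premises of some node. -/
def premEdges (R : Net Op) : List ℕ := R.flatMap Cell.premEdges

/-- The conclusions of the net: the edges which are not premises of any node, with their types. -/
def concls (R : Net Op) : List (ℕ × Formula) :=
  (R.flatMap Cell.concls).filter fun x => x.1 ∉ R.premEdges

/-- Renaming of the edges at depth `0`. -/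
def rename (ρ : ℕ → ℕ) (R : Net Op) : Net Op := R.map (Cell.rename ρ)

end Net

/-- The constraints on a single node: sync nodes have positive types, `⊥`-boxes have an auxiliary
conclusion, and the conclusions of the content of a box are the premises of its doors. -/
def Cell.TypedNode : Cell Op → Prop
  | .sync _ ps => ∀ p ∈ ps, p.ty.IsPositive
  | .botBox _ ds S₀ S₁ => ds ≠ [] ∧
      (Net.concls S₀).Perm (ds.map fun d => (d.left, d.ty)) ∧
      (Net.concls S₁).Perm (ds.map fun d => (d.right, d.ty))
  | .expBox none A a _ ds S =>
      (Net.concls S).Perm ((a, A) :: ds.map fun d => (d.inner, .quest d.ty))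
  | .expBox (some r) A a _ ds S =>
      (Net.concls S).Perm
        ((a, A) :: (r, .quest A.dual) :: ds.map fun d => (d.inner, .quest d.ty))
  | _ => True

/-- Well-typedness at depth `0`: each edge is a conclusion of exactly one node and a premise of at
most one node, with the same type at both ends. -/
structure Net.TypedSurface (R : Net Op) : Prop where
  node : ∀ c ∈ R, c.TypedNode
  concl_unique : R.edges.Nodup
  prem_unique : R.premEdges.Nodup
  prem_concl : ∀ x ∈ R.flatMap Cell.prems, x ∈ R.flatMap Cell.concls

/-- A property of nets holds for `R` and for all pre-nets associated to boxes of `R`, at any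
depth. -/
inductive Net.AllDepths (p : Net Op → Prop) : Net Op → Prop
  | mk {R : Net Op} (surface : p R)
      (inside : ∀ c ∈ R, ∀ S ∈ c.contents, Net.AllDepths p S) : Net.AllDepths p R

/-- Pre-nets: well-typed graphs. -/
def Net.IsPreNet (R : Net Op) : Prop := R.AllDepths Net.TypedSurface

/-! ### Correctness -/

/-- The edge `w` joins the nodes number `i` and `j` (in either direction). -/
def Net.Joins (R : Net Op) (w : ℕ) (i j : Fin R.length) : Prop :=
  (w ∈ R[i].conclEdges ∧ w ∈ R[j].premEdges) ∨ (w ∈ R[j].conclEdges ∧ w ∈ R[i].premEdges)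

/-- A cyclic switching path with `n + 1` nodes and edges: an undirected simple cycle (node `v i` and
node `v (i + 1)` are joined by the edge `e i`, indices being taken modulo `n + 1`), using at most
one of the premises of each `⅋` and `?c` node and at most one of the conclusions of each sync
node. -/
structure Net.IsSwitchingCycle (R : Net Op) (n : ℕ) (v : Fin (n + 1) → Fin R.length)
    (e : Fin (n + 1) → ℕ) : Prop where
  nodes_distinct : Function.Injective v
  edges_distinct : Function.Injective e
  joins : ∀ i, R.Joins (e i) (v i) (v (i + 1))
  switch_prem : ∀ c ∈ R, c.IsParOrContr →
    ∀ i j, e i ∈ c.premEdges → e j ∈ c.premEdges → e i = e j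
  switch_concl : ∀ c ∈ R, c.IsSync →
    ∀ i j, e i ∈ c.conclEdges → e j ∈ c.conclEdges → e i = e j

/-- No switching path is cyclic, at depth `0`. -/
def Net.AcyclicSurface (R : Net Op) : Prop := ∀ n v e, ¬ R.IsSwitchingCycle n v e

/-- The correctness criterion: no switching path is cyclic, and the contents of the boxes are
themselves correct. -/
def Net.IsCorrect (R : Net Op) : Prop := R.AllDepths Net.AcyclicSurface

/-- The net contains a cut node, at any depth. -/
inductive Net.HasCut : Net Op → Prop
  | surface {R : Net Op} {A : Formula} {e f : ℕ} (h : Cell.cut A e f ∈ R) : Net.HasCut R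
  | inside {R : Net Op} {c : Cell Op} {S : Net Op} (hc : c ∈ R) (hS : S ∈ c.contents)
      (h : Net.HasCut S) : Net.HasCut R

/-! ### Distributions -/

/-- Probability distributions in the wide sense: functions `μ : α → [0, 1]` of total mass at
most `1`. -/
def Dist (α : Type u) := {μ : α → ℝ≥0∞ // ∑' a, μ a ≤ 1}

namespace Dist

open Classical in
/-- The distribution `{a¹}`. -/
noncomputable def dirac {α : Type u} (a : α) : Dist α :=
  ⟨fun b => if b = a then 1 else 0, by rw [tsum_ite_eq]⟩

/-- The distribution `∑ₐ μ(a) · κ(a)`. -/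
noncomputable def bind {α : Type u} {β : Type v} (μ : Dist α) (κ : α → Dist β) : Dist β :=
  ⟨fun b => ∑' a, μ.1 a * (κ a).1 b, by
    rw [ENNReal.tsum_comm]
    refine le_trans (ENNReal.tsum_le_tsum fun a => ?_) μ.2
    rw [ENNReal.tsum_mul_left]
    exact mul_le_of_le_one_right' (κ a).2⟩

/-- The image distribution. -/
noncomputable def map {α : Type u} {β : Type v} (f : α → β) (μ : Dist α) : Dist β :=
  μ.bind fun a => dirac (f a)

end Dist

/-! ### Memory structures -/

/-- The group of finitary permutations of `I`. -/
def FinPerm (I : Type u) : Subgroup (Equiv.Perm I) where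
  carrier := {σ | {i | σ i ≠ i}.Finite}
  one_mem' := by simp
  mul_mem' := by
    intro σ τ hσ hτ
    refine (hσ.union hτ).subset fun i hi => ?_
    by_contra h
    simp only [Set.mem_union, Set.mem_ofPred_eq, not_or, not_not] at h
    exact hi (by rw [Equiv.Perm.mul_apply, h.2, h.1])
  inv_mem' := by
    intro σ hσ
    refine Set.Finite.subset hσ fun i hi h => hi ?_
    rw [Equiv.Perm.inv_eq_iff_eq]
    exact h.symm

/-- The smallest finite support of an element of a set with an action of the finitary
permutations. -/
def supp (I : Type u) {X : Type v} [MulAction (FinPerm I) X] (x : X) : Set I :=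
  ⋂₀ {A : Set I | A.Finite ∧ MulAction.Supports (FinPerm I) A x}

/-- Memory structures: `I` is the set of addresses, `Mem` the nominal set of memories, `Op` the set
of operations. -/
structure MemoryStructure (I : Type u) (Mem : Type v) (Op : Type w)
    [MulAction (FinPerm I) Mem] where
  countable_addr : Countable I
  infinite_addr : Infinite I
  finite_op : Finite Op
  nominal : ∀ m : Mem, ∃ A : Set I, A.Finite ∧ MulAction.Supports (FinPerm I) A m
  test : I → Mem → Dist (Bool × Mem)
  update : List I → Op → Mem → Option Mem
  arity : Op → ℕ
  test_equivariant : ∀ (σ : FinPerm I) i m,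
    test (σ • i) (σ • m) = (test i m).map fun x => (x.1, σ • x.2)
  update_equivariant : ∀ (σ : FinPerm I) is x m,
    update (is.map (σ • ·)) x (σ • m) = (update is x m).map (σ • ·)
  update_defined : ∀ is x m, (update is x m).isSome ↔ is.Nodup ∧ arity x = is.length
  update_update : ∀ is js x y m, is.Disjoint js →
    (update js y m).bind (update is x) = (update is x m).bind (update js y)
  test_test : ∀ i j m, i ≠ j →
    (test i m).bind (fun x => (test j x.2).map fun y => (x.1, y.1, y.2)) =
      (test j m).bind (fun y => (test i y.2).map fun x => (x.1, y.1, x.2))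
  test_update : ∀ j is x m m', j ∉ is → update is x m = some m' →
    (test j m').map (fun y => (y.1, some y.2)) =
      (test j m).map (fun y => (y.1, update is x y.2))

/-! ### Program nets -/

/-- Occurrences of units: an edge and a path in its type. -/
abbrev Occ := ℕ × List Bool

/-- The occurrences of `⊥` in the conclusions of `R`. -/
def Net.botOccs (R : Net Op) : Set Occ :=
  {x | ∃ A, (x.1, A) ∈ R.concls ∧ A.subAt x.2 = some .bot}

/-- The occurrences of `1` which are conclusions of `one` nodes at the surface, and the occurrences
of `⊥` in the conclusions of `R`. -/
def Net.inputs (R : Net Op) : Set Occ :=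
  {x | Cell.one x.1 ∈ R ∧ x.2 = []} ∪ R.botOccs

/-- Triples `(R, ind, m)`. -/
structure Config (I : Type u) (Mem : Type v) (Op : Type w) where
  net : Net Op
  ind : Occ → Option I
  mem : Mem

section ProgramNets

variable {I : Type u} {Mem : Type v} {Op : Type w} [MulAction (FinPerm I) Mem]

/-- Every sync node at depth `0` has the arity of its name. -/
def Net.ArityOK (M : MemoryStructure I Mem Op) (R : Net Op) : Prop :=
  ∀ l ps, Cell.sync l ps ∈ R → (ps.map fun p => p.ty.countOne).sum = M.arity l

/-- Raw program nets. -/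
structure Config.IsRawProgramNet (M : MemoryStructure I Mem Op) (r : Config I Mem Op) : Prop where
  preNet : r.net.IsPreNet
  correct : r.net.IsCorrect
  arity : r.net.AllDepths (Net.ArityOK M)
  ind_dom : ∀ x i, r.ind x = some i → x ∈ r.net.inputs
  ind_inj : ∀ x y i, r.ind x = some i → r.ind y = some i → x = y
  ind_bot : ∀ x ∈ r.net.botOccs, (r.ind x).isSome

/-- The action of a finitary permutation on `(R, ind, m)`. -/
def Config.perm (σ : FinPerm I) (r : Config I Mem Op) : Config I Mem Op :=
  ⟨r.net, fun x => (r.ind x).map (σ • ·), σ • r.mem⟩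

/-- Equivalence over permutation of the addresses. -/
def Config.setoid (I : Type u) (Mem : Type v) (Op : Type w) [MulAction (FinPerm I) Mem] :
    Setoid (Config I Mem Op) where
  r a b := ∃ σ : FinPerm I, a.perm σ = b
  iseqv :=
    { refl := fun a => ⟨1, by
        obtain ⟨R, ind, m⟩ := a
        simp [Config.perm]⟩
      symm := by
        rintro a b ⟨σ, rfl⟩
        obtain ⟨R, ind, m⟩ := a
        exact ⟨σ⁻¹, by simp [Config.perm, Function.comp_def]⟩
      trans := by
        rintro a b c ⟨σ, rfl⟩ ⟨τ, rfl⟩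
        obtain ⟨R, ind, m⟩ := a
        exact ⟨τ * σ, by simp [Config.perm, Function.comp_def, mul_smul]⟩ }

/-- Equivalence classes of triples over permutation of the addresses.  The class of a raw program
net is a program net. -/
abbrev ConfigClass (I : Type u) (Mem : Type v) (Op : Type w) [MulAction (FinPerm I) Mem] :=
  Quotient (Config.setoid I Mem Op)

/-- The class `[(R, ind, m)]`. -/
def Config.toClass (r : Config I Mem Op) : ConfigClass I Mem Op :=
  Quotient.mk (Config.setoid I Mem Op) r

end ProgramNets

/-! ### Rewriting of nets

All the rules act at depth `0`.  The list of nodes of the net is, up to reordering, the redex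
followed by the other nodes `Δ`. -/

/-- `S'` is a copy of `S` in which the edge `x.1` takes the name `x.2` for every `x` in `ds`, and the
other edges take distinct names not in `used`. -/
def Net.IsCopy (S : Net Op) (ds : List (ℕ × ℕ)) (used : List ℕ) (S' : Net Op) : Prop :=
  ∃ ρ : ℕ → ℕ, Set.InjOn ρ {w | w ∈ S.edges} ∧ (∀ x ∈ ds, ρ x.1 = x.2) ∧
    (∀ w ∈ S.edges, w ∉ ds.map Prod.fst → ρ w ∉ used) ∧ S' = S.rename ρ

/-- The rewriting rules which act on the net only.  In `Rewrites R mv R'`, the list `mv` records the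
edges which are identified by the rule: for `(z, y)` in `mv`, the edge `z` of `R` becomes the edge
`y` of `R'`. -/
inductive Rewrites : Net Op → List (ℕ × ℕ) → Net Op → Prop
  /-- axiom: the cut of `z` against an axiom with conclusions `x` and `y` makes `z` and `y` one
  edge -/
  | ax {R Δ : Net Op} {c k : Cell Op} {A : Formula} {x y z : ℕ}
      (hR : R.Perm (c :: k :: Δ)) (hc : c.IsAx A x y) (hk : k.IsCut A x z) (hyz : y ≠ z) :
      Rewrites R [(z, y)] (Net.rename (fun t => if t = z then y else t) Δ)
  /-- multiplicative -/
  | mult {R Δ : Net Op} {k : Cell Op} {A B : Formula} {e f g e' f' g' : ℕ}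
      (hR : R.Perm (.tensor A B e f g :: .par A.dual B.dual e' f' g' :: k :: Δ))
      (hk : k.IsCut (.tensor A B) g g') :
      Rewrites R [] (.cut A e e' :: .cut B f f' :: Δ)
  /-- a sync node with a premise `e : P ⊗ Q` that is the conclusion of a `⊗` node commutes with it -/
  | syncTensor {R Δ : Net Op} {l : Op} {P Q : Formula} {a b e f a' b' : ℕ} {ps qs : List SyncPort}
      (hR : R.Perm (.sync l (ps ++ ⟨.tensor P Q, e, f⟩ :: qs) :: .tensor P Q a b e :: Δ))
      (ha : a' ∉ R.edges) (hb : b' ∉ R.edges) (hab : a' ≠ b') :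
      Rewrites R []
        (.sync l (ps ++ ⟨P, a, a'⟩ :: ⟨Q, b, b'⟩ :: qs) :: .tensor P Q a' b' f :: Δ)
  /-- dereliction of a closed `!`-box -/
  | der {R Δ S S' : Net Op} {k : Cell Op} {A : Formula} {a a' e f g : ℕ}
      (hR : R.Perm (.expBox none A a e [] S :: .der A.dual g f :: k :: Δ))
      (hk : k.IsCut (.bang A) e f)
      (ha : a' ∉ R.edges) (hS : S.IsCopy [(a, a')] R.edges S') :
      Rewrites R [] (.cut A a' g :: S' ++ Δ)
  /-- dereliction of a closed `Y`-box: its content is copied, and the copy of the conclusion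
  `r : ?A^⊥` is cut against the box itself -/
  | fix {R Δ S S' : Net Op} {k : Cell Op} {A : Formula} {a a' e f g r r' : ℕ}
      (hR : R.Perm (.expBox (some r) A a e [] S :: .der A.dual g f :: k :: Δ))
      (hk : k.IsCut (.bang A) e f)
      (ha : a' ∉ R.edges) (hr : r' ∉ R.edges)
      (hS : S.IsCopy [(a, a'), (r, r')] R.edges S') :
      Rewrites R []
        (.cut A a' g :: .expBox (some r) A a e [] S :: .cut (.bang A) e r' :: S' ++ Δ)
  /-- weakening of a closed exponential box -/
  | weak {R Δ S : Net Op} {k : Cell Op} {y : Option ℕ} {A : Formula} {a e f : ℕ}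
      (hR : R.Perm (.expBox y A a e [] S :: .weak A.dual f :: k :: Δ))
      (hk : k.IsCut (.bang A) e f) :
      Rewrites R [] Δ
  /-- contraction of a closed exponential box -/
  | contr {R Δ S : Net Op} {k : Cell Op} {y : Option ℕ} {A : Formula} {a e f g h e₁ e₂ : ℕ}
      (hR : R.Perm (.expBox y A a e [] S :: .contr A.dual g h f :: k :: Δ))
      (hk : k.IsCut (.bang A) e f)
      (h₁ : e₁ ∉ R.edges) (h₂ : e₂ ∉ R.edges) (h₁₂ : e₁ ≠ e₂) :
      Rewrites R []
        (.expBox y A a e₁ [] S :: .expBox y A a e₂ [] S ::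
          .cut (.bang A) e₁ g :: .cut (.bang A) e₂ h :: Δ)
  /-- a closed exponential box cut against an auxiliary door of an exponential box enters it -/
  | enter {R Δ S T : Net Op} {k : Cell Op} {y y' : Option ℕ} {A B : Formula}
      {a b e e' g : ℕ} {d : ExpDoor} {ds ds' : List ExpDoor}
      (hR : R.Perm (.expBox y A a e [] S :: .expBox y' B b g (ds ++ d :: ds') T :: k :: Δ))
      (hd : d.ty = A.dual) (hk : k.IsCut (.bang A) e d.outer)
      (he : e' ∉ Net.edges T) :
      Rewrites R []
        (.expBox y' B b g (ds ++ ds')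
          (.expBox y A a e' [] S :: .cut (.bang A) e' d.inner :: T) :: Δ)

/-- The sync rule: a sync node all of whose premises (of type `1`) are conclusions of `one` nodes is
erased, and the `one` nodes take its conclusions.  The node has name `l` and the pairs
(premise, conclusion) are listed, in order, by `ps`. -/
inductive RewritesSync : Net Op → Op → List (ℕ × ℕ) → Net Op → Prop
  | mk {R Δ : Net Op} {l : Op} {ps : List (ℕ × ℕ)}
      (hR : R.Perm (.sync l (ps.map fun p => ⟨.one, p.1, p.2⟩) ::
        (ps.map fun p => Cell.one p.1) ++ Δ)) :
      RewritesSync R l ps ((ps.map fun p => Cell.one p.2) ++ Δ)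

/-- The pair of rules for a `one` node of conclusion `e` cut against a `⊥`-box: the box is replaced
by its left content (giving `R₀`) or by its right content (giving `R₁`). -/
inductive RewritesTest : Net Op → ℕ → Net Op → Net Op → Prop
  | mk {R Δ S₀ S₁ S₀' S₁' : Net Op} {k : Cell Op} {e f : ℕ} {ds : List BotDoor}
      (hR : R.Perm (.one e :: .botBox f ds S₀ S₁ :: k :: Δ))
      (hk : k.IsCut .one e f)
      (h₀ : S₀.IsCopy (ds.map fun d => (d.left, d.outer)) R.edges S₀')
      (h₁ : S₁.IsCopy (ds.map fun d => (d.right, d.outer)) R.edges S₁') :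
      RewritesTest R e (S₀' ++ Δ) (S₁' ++ Δ)

/-! ### Reduction of program nets -/

section Reduction

variable {I : Type u} {Mem : Type v} {Op : Type w} [MulAction (FinPerm I) Mem]

/-- The map `ind` read on the edges of the reduct, when the edge `z` becomes `y` for each `(z, y)`
in `mv`. -/
def moveInd (mv : List (ℕ × ℕ)) (ind : Occ → Option I) : Occ → Option I := fun x =>
  ((mv.find? fun p => p.2 = x.1).bind fun p => ind (p.1, x.2)) <|>
    (if x.1 ∈ mv.map Prod.fst then none else ind x)

open Classical in
/-- The restriction of `ind` to a set of occurrences. -/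
noncomputable def restrictInd (X : Set Occ) (ind : Occ → Option I) : Occ → Option I := fun x =>
  if x ∈ X then ind x else none

open Classical in
/-- Reduction of raw program nets. -/
inductive RawStep (M : MemoryStructure I Mem Op) :
    Config I Mem Op → Dist (Config I Mem Op) → Prop
  /-- an inactive `one` node receives a fresh address -/
  | link {R : Net Op} {ind : Occ → Option I} {m : Mem} {e : ℕ} {i : I}
      (hone : Cell.one e ∈ R) (hund : ind (e, []) = none)
      (hind : ∀ x, ind x ≠ some i) (hm : i ∉ supp I m) :
      RawStep M ⟨R, ind, m⟩ (Dist.dirac ⟨R, Function.update ind (e, []) (some i), m⟩)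
  /-- sync rule, all the `one` nodes being active, with addresses `is` -/
  | update {R R' : Net Op} {ind : Occ → Option I} {m m' : Mem} {l : Op} {ps : List (ℕ × ℕ)}
      {is : List I}
      (hR : RewritesSync R l ps R')
      (hact : (ps.map fun p => ind (p.1, [])) = is.map some)
      (hm : M.update is l m = some m') :
      RawStep M ⟨R, ind, m⟩ (Dist.dirac ⟨R', moveInd ps ind, m'⟩)
  /-- an active `one` node, of address `i`, opens a `⊥`-box -/
  | test {R R₀ R₁ : Net Op} {ind : Occ → Option I} {m : Mem} {e : ℕ} {i : I}
      (hR : RewritesTest R e R₀ R₁) (hact : ind (e, []) = some i) :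
      RawStep M ⟨R, ind, m⟩ ((M.test i m).map fun x =>
        if x.1 = false then ⟨R₀, restrictInd R₀.inputs ind, x.2⟩
        else ⟨R₁, restrictInd R₁.inputs ind, x.2⟩)
  /-- the other rules do not act on the memory -/
  | net {R R' : Net Op} {ind : Occ → Option I} {m : Mem} {mv : List (ℕ × ℕ)}
      (hR : Rewrites R mv R') :
      RawStep M ⟨R, ind, m⟩ (Dist.dirac ⟨R', moveInd mv ind, m⟩)

/-- Reduction of program nets: the reduction of raw program nets, read on classes. -/
def Step (M : MemoryStructure I Mem Op) (R : ConfigClass I Mem Op)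
    (μ : Dist (ConfigClass I Mem Op)) : Prop :=
  ∃ r ν, r.toClass = R ∧ RawStep M r ν ∧ μ = ν.map Config.toClass

/-- `R` is in normal form. -/
def IsNormal (M : MemoryStructure I Mem Op) (R : ConfigClass I Mem Op) : Prop :=
  ¬ ∃ μ, Step M R μ

end Reduction

end SMEYLL

/-! Suppose that no step is possible. An inactive surface `one` node could be linked, since
infinitely many addresses are free, so all of them are active; hence no net, test or sync redex
exists at the surface, and only the shape of the graph matters (`Net.Stuck`,
`Config.IsRawProgramNet.stuck`).

In a stuck net consider walks that go up through sync nodes, turn at axioms, enter a `⊥`-box by an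
auxiliary door and leave by the principal one, enter a non-closed exponential box by its principal
door and leave by an auxiliary one, and otherwise descend, bouncing at cuts. An edge is followed
downwards only if its type contains `⊥`, `!` or `?`; by the hypothesis on conclusions it is then a
premise of some node, and never of a sync node, whose types are positive. The absence of redexes
ensures that the walk can always be continued (`step_up`, `step_down`). Such a walk respects all
switchings, so in a finite graph it closes up into a switching cycle, contradicting correctness
(`Net.AcyclicSurface.no_walk`). Hence no walk can even start.

Every surface cut would start one (`up_of_cut`), so there are none. Any edge with `⊥`, `!` or `?` in
its type would then also start one, so there are no such edges. In particular there are no boxes,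
whose principal conclusions have type `⊥` or `!A`, and therefore no cuts at greater depth
(`not_hasCut`). -/

namespace SMEYLL

universe u v w

variable {Op : Type u}

/-! ### Duality, positivity and the symbols `⊥`, `!`, `?` -/

namespace Formula

theorem dual_dual (A : Formula) : A.dual.dual = A := by
  induction A <;> simp_all [dual]

theorem IsPositive.noBotExp {A : Formula} (h : A.IsPositive) : A.NoBotExp := by
  induction A <;> simp_all [IsPositive, NoBotExp]

theorem IsPositive.not_noBotExp_dual {A : Formula} (h : A.IsPositive) : ¬ A.dual.NoBotExp := by
  induction A <;> simp_all [IsPositive, NoBotExp, dual]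

theorem NoBotExp.subAt_ne_bot {A : Formula} (h : A.NoBotExp) (p : List Bool) :
    A.subAt p ≠ some bot := by
  induction A generalizing p with
  | one => cases p <;> simp [subAt]
  | bot => exact h.elim
  | tensor A B ihA ihB =>
    rcases p with _ | ⟨_ | _, p⟩
    · simp [subAt]
    · simpa [subAt] using ihA h.1 p
    · simpa [subAt] using ihB h.2 p
  | par A B ihA ihB =>
    rcases p with _ | ⟨_ | _, p⟩
    · simp [subAt]
    · simpa [subAt] using ihA h.1 p
    · simpa [subAt] using ihB h.2 p
  | bang A => exact h.elim
  | quest A => exact h.elim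

end Formula

/-! ### Lists of nodes and uniqueness of edges -/

/-- Isolates a redex: distinct nodes of a net can be brought to the front, as the rewriting rules
require. -/
theorem exists_perm_append {α : Type u} {L R : List α} (hL : L.Nodup) (h : ∀ x ∈ L, x ∈ R) :
    ∃ Δ, R.Perm (L ++ Δ) := by
  obtain ⟨l, hl, hs⟩ := List.subperm_of_subset hL h
  obtain ⟨Δ, hΔ⟩ := hs.exists_perm_append
  exact ⟨Δ, hΔ.trans (hl.append_right Δ)⟩

theorem eq_of_mem_flatMap_nodup {α β : Type*} {f : α → List β} {L : List α}
    (h : (L.flatMap f).Nodup) {x : β} {i j : Fin L.length} (hi : x ∈ f L[i]) (hj : x ∈ f L[j]) :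
    i = j := by
  have h2 := (List.nodup_flatMap.1 h).2
  rw [List.pairwise_iff_getElem] at h2
  rcases lt_trichotomy i j with hij | hij | hij
  · exact (h2 i j i.2 j.2 hij hi hj).elim
  · exact hij
  · exact (h2 j i j.2 i.2 hij hj hi).elim

theorem exists_index {α : Type*} {L : List α} {x : α} (h : x ∈ L) : ∃ i : Fin L.length, L[i] = x := by
  obtain ⟨i, hi, rfl⟩ := List.getElem_of_mem h
  exact ⟨⟨i, hi⟩, rfl⟩

/-- The premises (`true`) or the conclusions (`false`) of a node. -/
def Cell.side (c : Cell Op) : Bool → List ℕ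
  | true => c.premEdges
  | false => c.conclEdges

theorem Net.TypedSurface.side_unique {R : Net Op} (hR : R.TypedSurface) (b : Bool) {w : ℕ}
    {i j : Fin R.length} (hi : w ∈ R[i].side b) (hj : w ∈ R[j].side b) : i = j := by
  cases b
  · exact eq_of_mem_flatMap_nodup hR.concl_unique hi hj
  · exact eq_of_mem_flatMap_nodup hR.prem_unique hi hj

theorem Net.TypedSurface.eq_of_conclEdges {R : Net Op} (hR : R.TypedSurface) {c c' : Cell Op}
    (hc : c ∈ R) (hc' : c' ∈ R) {w : ℕ} (h : w ∈ c.conclEdges) (h' : w ∈ c'.conclEdges) :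
    c = c' := by
  obtain ⟨i, rfl⟩ := exists_index hc
  obtain ⟨j, rfl⟩ := exists_index hc'
  rw [hR.side_unique false h h']

theorem Net.TypedSurface.conclEdges_nodup {R : Net Op} (hR : R.TypedSurface) {c : Cell Op}
    (hc : c ∈ R) : c.conclEdges.Nodup :=
  (List.nodup_flatMap.1 hR.concl_unique).1 c hc

theorem Net.TypedSurface.premEdges_nodup {R : Net Op} (hR : R.TypedSurface) {c : Cell Op}
    (hc : c ∈ R) : c.premEdges.Nodup :=
  (List.nodup_flatMap.1 hR.prem_unique).1 c hc

theorem Net.edges_eq_map (R : Net Op) : R.edges = (R.flatMap Cell.concls).map Prod.fst := by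
  rw [List.map_flatMap]
  rfl

theorem Net.TypedSurface.type_unique {R : Net Op} (hR : R.TypedSurface) {w : ℕ} {A B : Formula}
    (hA : (w, A) ∈ R.flatMap Cell.concls) (hB : (w, B) ∈ R.flatMap Cell.concls) : A = B := by
  have h := hR.concl_unique
  rw [Net.edges_eq_map] at h
  exact congrArg Prod.snd (List.inj_on_of_nodup_map h hA hB rfl)

theorem Net.TypedSurface.concls_nodup {R : Net Op} (hR : R.TypedSurface) :
    (R.concls.map Prod.fst).Nodup := by
  have h := hR.concl_unique
  rw [Net.edges_eq_map] at h
  exact h.sublist (List.filter_sublist.map _)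

/-! ### Infinite walks and switching cycles -/

/-- In a correct typed net there is no infinite walk that never ascends through `⅋` and `?c` nodes,
never descends through sync nodes and never turns back.  A state `w, d` of the walk is an edge `w`
crossed downwards (`d = true`) or upwards (`d = false`). -/
theorem Net.AcyclicSurface.no_walk {R : Net Op} (hac : R.AcyclicSurface) (hR : R.TypedSurface)
    {P : ℕ → Bool → Prop}
    (hstep : ∀ w d, P w d → ∃ w' d', P w' d' ∧ ∃ c ∈ R, w ∈ c.side d ∧ w' ∈ c.side (!d') ∧
      (c.IsParOrContr → d' = true) ∧ (c.IsSync → d' = false) ∧ (w' = w → d' = d))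
    (w : ℕ) (d : Bool) : ¬ P w d := by
  intro hwd
  have hstep' : ∀ s : {s : ℕ × Bool // P s.1 s.2}, ∃ s' : {s : ℕ × Bool // P s.1 s.2},
      ∃ i : Fin R.length, s.1.1 ∈ R[i].side s.1.2 ∧ s'.1.1 ∈ R[i].side (!s'.1.2) ∧
      (R[i].IsParOrContr → s'.1.2 = true) ∧ (R[i].IsSync → s'.1.2 = false) ∧
      (s'.1.1 = s.1.1 → s'.1.2 = s.1.2) := by
    rintro ⟨⟨w, d⟩, h⟩
    obtain ⟨w', d', h', c, hc, h⟩ := hstep w d h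
    obtain ⟨i, rfl⟩ := exists_index hc
    exact ⟨⟨(w', d'), h'⟩, i, h⟩
  choose next node hin hout hpar hsync hturn using hstep'
  set s : ℕ → {s : ℕ × Bool // P s.1 s.2} := fun k => next^[k] ⟨(w, d), hwd⟩
  have hsucc : ∀ k, s (k + 1) = next (s k) := fun k => Function.iterate_succ_apply' next k _
  -- Pigeonhole: the net is finite, so some node is visited twice.
  have hrep : ∃ n, ∃ i, node (s i) = node (s (i + n + 1)) := by
    obtain ⟨k, l, hkl, h⟩ := Finite.exists_ne_map_eq_of_infinite fun k => node (s k)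
    rcases lt_or_gt_of_ne hkl with hlt | hlt
    · exact ⟨l - k - 1, k, by rw [show k + (l - k - 1) + 1 = l by omega]; exact h⟩
    · exact ⟨k - l - 1, l, by rw [show l + (k - l - 1) + 1 = k by omega]; exact h.symm⟩
  classical
  -- Among all returns to a node, take one with the least gap `n + 1`. The `n + 1` nodes visited in
  -- between are then distinct and form the cycle; the edge leaving node `t` is that of state `i + t
  -- + 1`.
  obtain ⟨i, hi⟩ := Nat.find_spec hrep
  have hmin : ∀ m < Nat.find hrep, ∀ j, node (s j) ≠ node (s (j + m + 1)) :=
    fun m hm j hj => Nat.find_min hrep hm ⟨j, hj⟩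
  set n := Nat.find hrep
  have hlt : ∀ t t' : Fin (n + 1), t < t' → node (s (i + t)) ≠ node (s (i + t')) := by
    intro t t' htt h
    have h1 : t.1 < t'.1 := htt
    have h2 := t'.2
    refine hmin (t' - t - 1) (by omega) (i + t) ?_
    rw [show i + t.1 + (t'.1 - t - 1) + 1 = i + t' by omega]
    exact h
  have hinj : Function.Injective fun t : Fin (n + 1) => node (s (i + t)) := by
    intro t t' h
    rcases lt_trichotomy t t' with h' | h' | h'
    · exact (hlt _ _ h' h).elim
    · exact h'
    · exact (hlt _ _ h' h.symm).elim
  have hval : ∀ t : Fin (n + 1), t ≠ Fin.last n → (t + 1 : Fin (n + 1)).1 = t + 1 := by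
    intro t ht
    exact Fin.val_add_one_of_lt (Fin.lt_last_iff_ne_last.2 ht)
  have hv : ∀ t : Fin (n + 1),
      node (s (i + (t + 1 : Fin (n + 1)))) = node (s (i + t + 1)) := by
    intro t
    by_cases ht : t = Fin.last n
    · subst ht
      simpa using hi
    · rw [hval t ht, ← add_assoc]
  have hsrc : ∀ t : Fin (n + 1),
      (s (i + t + 1)).1.1 ∈ R[node (s (i + t))].side (!(s (i + t + 1)).1.2) := by
    intro t
    rw [hsucc]
    exact hout _
  have htgt : ∀ t : Fin (n + 1), (s (i + t + 1)).1.1 ∈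
      R[node (s (i + (t + 1 : Fin (n + 1))))].side (s (i + t + 1)).1.2 := by
    intro t
    have hcast : ∀ p q : Fin R.length, p = q → ∀ x b, x ∈ R[q].side b → x ∈ R[p].side b := by
      rintro p _ rfl _ _ h
      exact h
    exact hcast _ _ (hv t) _ _ (hin _)
  have hconsec : ∀ t t' : Fin (n + 1), t'.1 = t + 1 →
      (s (i + t' + 1)).1.1 = (s (i + t + 1)).1.1 → (s (i + t' + 1)).1.2 = (s (i + t + 1)).1.2 := by
    intro t t' htt
    rw [htt, ← add_assoc, hsucc (i + t + 1)]
    exact hturn _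
  have hedge : ∀ t t' : Fin (n + 1), (s (i + t + 1)).1.1 = (s (i + t' + 1)).1.1 →
      (s (i + t + 1)).1.2 = (s (i + t' + 1)).1.2 → t = t' := by
    intro t t' h h'
    have h1 := hsrc t
    rw [h, h'] at h1
    exact hinj (hR.side_unique _ h1 (hsrc t'))
  refine hac n (fun t => node (s (i + t))) (fun t => (s (i + t + 1)).1.1)
    ⟨hinj, ?_, ?_, ?_, ?_⟩
  · intro t t' h
    change (s (i + t + 1)).1.1 = (s (i + t' + 1)).1.1 at h
    -- An edge crossed twice in the same direction leaves the same node twice. Crossed in opposite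
    -- directions, it joins two nodes that follow each other both ways round, so one of the two
    -- crossings immediately reverses the other, which the walk forbids.
    by_contra hne
    have hd : (s (i + t + 1)).1.2 ≠ (s (i + t' + 1)).1.2 := fun hd => hne (hedge t t' h hd)
    have hd1 : (s (i + t + 1)).1.2 = !(s (i + t' + 1)).1.2 := Bool.eq_not.2 hd
    have hd2 : (s (i + t' + 1)).1.2 = !(s (i + t + 1)).1.2 := Bool.eq_not.2 hd.symm
    have e1 : t + 1 = t' := by
      have h1 := htgt t
      have h2 := hsrc t'
      rw [← hd1, ← h] at h2
      exact hinj (hR.side_unique _ h1 h2)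
    have e2 : t' + 1 = t := by
      have h1 := htgt t'
      have h2 := hsrc t
      rw [← hd2, h] at h2
      exact hinj (hR.side_unique _ h1 h2)
    by_cases ht : t = Fin.last n
    · by_cases ht' : t' = Fin.last n
      · exact hne (ht.trans ht'.symm)
      · refine hd (hconsec t' t ?_ h)
        rw [← hval t' ht', e2]
    · refine hd (hconsec t t' ?_ h.symm).symm
      rw [← hval t ht, e1]
  · intro t
    have h1 := hsrc t
    have h2 := htgt t
    revert h1 h2
    cases (s (i + t + 1)).1.2
    · exact fun h1 h2 => Or.inr ⟨h2, h1⟩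
    · exact fun h1 h2 => Or.inl ⟨h1, h2⟩
  · intro c hc hpc
    -- A premise of a `⅋` or `?c` node on the cycle is crossed downwards, into that node, because
    -- the walk never leaves such a node upwards. The cycle enters each node only once. Sync nodes
    -- are treated dually below.
    obtain ⟨p, rfl⟩ := exists_index hc
    have key : ∀ t : Fin (n + 1), (s (i + t + 1)).1.1 ∈ R[p].premEdges →
        p = node (s (i + (t + 1 : Fin (n + 1)))) := by
      intro t ht
      have h1 := hsrc t
      have h2 := htgt t
      rcases hb : (s (i + t + 1)).1.2 with _ | _
      · rw [hb] at h1
        have hp := hR.side_unique true ht h1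
        have := hpar (s (i + t)) (by rw [← hp]; exact hpc)
        rw [← hsucc, hb] at this
        cases this
      · rw [hb] at h2
        exact hR.side_unique true ht h2
    intro t t' ht ht'
    have := add_right_cancel (hinj ((key t ht).symm.trans (key t' ht')))
    rw [this]
  · intro c hc hsc
    obtain ⟨p, rfl⟩ := exists_index hc
    have key : ∀ t : Fin (n + 1), (s (i + t + 1)).1.1 ∈ R[p].conclEdges →
        p = node (s (i + (t + 1 : Fin (n + 1)))) := by
      intro t ht
      have h1 := hsrc t
      have h2 := htgt t
      rcases hb : (s (i + t + 1)).1.2 with _ | _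
      · rw [hb] at h2
        exact hR.side_unique false ht h2
      · rw [hb] at h1
        have hp := hR.side_unique false ht h1
        have := hsync (s (i + t)) (by rw [← hp]; exact hsc)
        rw [← hsucc, hb] at this
        cases this
    intro t t' ht ht'
    have := add_right_cancel (hinj ((key t ht).symm.trans (key t' ht')))
    rw [this]

/-! ### Fresh copies of box contents -/

/-- Doors receive their prescribed names; every other edge is shifted by a number `N` exceeding all
used and prescribed names, so nothing collides. -/
theorem Net.exists_isCopy (S : Net Op) {ds : List (ℕ × ℕ)} (used : List ℕ)
    (h₁ : (ds.map Prod.fst).Nodup) (h₂ : (ds.map Prod.snd).Nodup) :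
    ∃ S', S.IsCopy ds used S' := by
  classical
  obtain ⟨N, hN⟩ : ∃ N, ∀ x ∈ used ++ ds.map Prod.snd, x < N := by
    obtain ⟨N, hN⟩ := (used ++ ds.map Prod.snd).toFinset.bddAbove
    exact ⟨N + 1, fun x hx => Nat.lt_succ_of_le (hN (by simpa using hx))⟩
  have hex : ∀ w, ∃ v, (∀ x ∈ ds, x.1 = w → v = x.2) ∧ (w ∉ ds.map Prod.fst → v = N + w) := by
    intro w
    by_cases hw : w ∈ ds.map Prod.fst
    · obtain ⟨x, hx, rfl⟩ := List.mem_map.1 hw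
      exact ⟨x.2, fun y hy hyx => by rw [List.inj_on_of_nodup_map h₁ hy hx hyx],
        fun h => (h hw).elim⟩
    · exact ⟨N + w, fun x hx hxw => (hw (List.mem_map.2 ⟨x, hx, hxw⟩)).elim, fun _ => rfl⟩
  choose ρ hρ hρ' using hex
  have hlow : ∀ w ∈ ds.map Prod.fst, ρ w < N := by
    intro w hw
    obtain ⟨x, hx, rfl⟩ := List.mem_map.1 hw
    rw [hρ _ x hx rfl]
    exact hN _ (List.mem_append_right _ (List.mem_map_of_mem hx))
  refine ⟨_, ρ, ?_, fun x hx => hρ _ x hx rfl, ?_, rfl⟩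
  · intro w _ w' _ h
    by_cases hw : w ∈ ds.map Prod.fst <;> by_cases hw' : w' ∈ ds.map Prod.fst
    · obtain ⟨x, hx, rfl⟩ := List.mem_map.1 hw
      obtain ⟨y, hy, rfl⟩ := List.mem_map.1 hw'
      rw [hρ _ x hx rfl, hρ _ y hy rfl] at h
      rw [List.inj_on_of_nodup_map h₂ hx hy h]
    · have := hlow w hw
      have := hρ' w' hw'
      omega
    · have := hlow w' hw'
      have := hρ' w hw
      omega
    · have := hρ' w hw
      have := hρ' w' hw'
      omega
  · intro w _ hw hu
    have := hN _ (List.mem_append_left _ hu)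
    have := hρ' w hw
    omega

/-! ### Premises of cuts -/

theorem Cell.IsCut.symm {k : Cell Op} {A : Formula} {e f : ℕ} (h : k.IsCut A e f) :
    k.IsCut A.dual f e := by
  rcases h with rfl | rfl
  · exact Or.inr (by rw [Formula.dual_dual])
  · exact Or.inl rfl

theorem Cell.IsCut.ne {R : Net Op} (hR : R.TypedSurface) {k : Cell Op} (hk : k ∈ R) {A : Formula}
    {e f : ℕ} (h : k.IsCut A e f) : e ≠ f := by
  have hn := hR.premEdges_nodup hk
  rcases h with rfl | rfl
  · simpa [Cell.premEdges, Cell.prems] using hn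
  · simpa [Cell.premEdges, Cell.prems, eq_comm] using hn

theorem Cell.IsCut.mem_left {R : Net Op} (hR : R.TypedSurface) {k : Cell Op} (hk : k ∈ R)
    {A : Formula} {e f : ℕ} (h : k.IsCut A e f) : (e, A) ∈ R.flatMap Cell.concls := by
  apply hR.prem_concl
  refine List.mem_flatMap.2 ⟨k, hk, ?_⟩
  rcases h with rfl | rfl <;> simp [Cell.prems, Formula.dual_dual]

theorem Cell.IsCut.mem_right {R : Net Op} (hR : R.TypedSurface) {k : Cell Op} (hk : k ∈ R)
    {A : Formula} {e f : ℕ} (h : k.IsCut A e f) : (f, A.dual) ∈ R.flatMap Cell.concls :=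
  h.symm.mem_left hR hk

/-! ### States of the walk, and stuck nets -/

/-- The conclusions through which a node can be entered upwards. -/
def Cell.UpPort : Cell Op → ℕ → Prop
  | sync _ ps, w => w ∈ ps.map SyncPort.concl
  | botBox _ ds _ _, w => w ∈ ds.map BotDoor.outer
  | expBox _ _ _ e ds _, w => w = e ∧ ds ≠ []
  | ax A e f, w => (w = e ∧ A.IsPositive) ∨ (w = f ∧ A.dual.IsPositive)
  | _, _ => False

theorem Cell.UpPort.mem {c : Cell Op} {w : ℕ} (h : c.UpPort w) : w ∈ c.conclEdges := by
  cases c <;> simp only [Cell.UpPort] at h <;>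
    simp only [Cell.conclEdges, Cell.concls, List.map_cons, List.map_nil, List.map_map,
      Function.comp_def, List.mem_cons, List.not_mem_nil, or_false]
  · exact h.imp And.left And.left
  · exact h
  · exact Or.inr h
  · exact Or.inl h.1

/-- The edge `w` can be followed upwards. -/
def Net.Up (R : Net Op) (w : ℕ) : Prop := ∃ c ∈ R, c.UpPort w

/-- The edge `w` can be followed downwards, to a node or beyond a cut. -/
def Net.Down (R : Net Op) (w : ℕ) : Prop :=
  ∃ T, (w, T) ∈ R.flatMap Cell.concls ∧ ¬ T.NoBotExp ∧
    ∀ k ∈ R, ∀ A f, k.IsCut A w f → R.Up f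

/-- The net is typed, and no rule acting on the net applies. -/
structure Net.Stuck (R : Net Op) : Prop where
  preNet : R.IsPreNet
  acyclic : R.AcyclicSurface
  rewrites : ∀ mv R', ¬ Rewrites R mv R'
  test : ∀ e R₀ R₁, ¬ RewritesTest R e R₀ R₁
  sync : ∀ l ps R', ¬ RewritesSync R l ps R'

theorem Net.AllDepths.here {p : Net Op → Prop} {R : Net Op} (h : R.AllDepths p) : p R := by
  cases h with
  | mk h _ => exact h

theorem Net.AllDepths.content {p : Net Op → Prop} {R : Net Op} (h : R.AllDepths p) {c : Cell Op}
    (hc : c ∈ R) {S : Net Op} (hS : S ∈ c.contents) : p S := by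
  cases h with
  | mk _ h => exact (h c hc S hS).here

theorem exists_not_mem_pair (L : List ℕ) : ∃ a b, a ∉ L ∧ b ∉ L ∧ a ≠ b := by
  obtain ⟨a, ha⟩ := L.toFinset.exists_notMem
  obtain ⟨b, hb⟩ := (insert a L.toFinset).exists_notMem
  simp only [Finset.mem_insert, not_or, List.mem_toFinset] at ha hb
  exact ⟨a, b, ha, hb.2, fun h => hb.1 h.symm⟩

/-! ### Every cut of a stuck net starts a walk -/

namespace Net.Stuck

variable {R : Net Op}

theorem typed (h : R.Stuck) : R.TypedSurface := h.preNet.here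

theorem not_up (h : R.Stuck) {c : Cell Op} (hc : c ∈ R) {w : ℕ} (hw : w ∈ c.conclEdges)
    (hn : ¬ c.UpPort w) : ¬ R.Up w := by
  rintro ⟨c', hc', hu⟩
  rw [h.typed.eq_of_conclEdges hc hc' hw hu.mem] at hn
  exact hn hu

theorem not_ax_of_cut (h : R.Stuck) {k c : Cell Op} (hk : k ∈ R) (hc : c ∈ R) {A B : Formula}
    {e f x y : ℕ} (hcut : k.IsCut A e f) (he : (e, A) ∈ c.concls) : c ≠ .ax B x y := by
  rintro rfl
  obtain ⟨z, hz⟩ : ∃ z, (Cell.ax B x y : Cell Op).IsAx A e z := by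
    simp only [Cell.concls, List.mem_cons, Prod.mk.injEq, List.not_mem_nil, or_false] at he
    rcases he with ⟨rfl, rfl⟩ | ⟨rfl, rfl⟩
    · exact ⟨y, Or.inl rfl⟩
    · exact ⟨x, Or.inr (by rw [Formula.dual_dual])⟩
  have hez : e ∈ (Cell.ax B x y : Cell Op).conclEdges ∧
      z ∈ (Cell.ax B x y : Cell Op).conclEdges := by
    rcases hz with hz | hz <;> rw [hz] <;> simp [Cell.conclEdges, Cell.concls]
  -- An axiom whose two conclusions are cut against each other is not a redex, but it is a switching
  -- cycle with two nodes.
  by_cases hzf : z = f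
  · subst hzf
    have hne := hcut.ne h.typed hk
    have hpk : e ∈ k.premEdges ∧ z ∈ k.premEdges := by
      rcases hcut with rfl | rfl <;> simp [Cell.premEdges, Cell.prems]
    have hkp : ¬ k.IsParOrContr := by rcases hcut with rfl | rfl <;> exact id
    have hks : ¬ k.IsSync := by rcases hcut with rfl | rfl <;> exact id
    refine h.acyclic.no_walk h.typed
      (P := fun w d => (w = e ∧ d = true) ∨ (w = z ∧ d = false)) ?_ e true (Or.inl ⟨rfl, rfl⟩)
    rintro w d (⟨rfl, rfl⟩ | ⟨rfl, rfl⟩)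
    · exact ⟨z, false, Or.inr ⟨rfl, rfl⟩, k, hk, hpk.1, hpk.2, fun h => (hkp h).elim,
        fun h => (hks h).elim, fun h => (hne h.symm).elim⟩
    · exact ⟨e, true, Or.inl ⟨rfl, rfl⟩, _, hc, hez.2, hez.1, fun _ => rfl,
        fun h => h.elim, fun h => (hne h).elim⟩
  · obtain ⟨Δ, hΔ⟩ := exists_perm_append (L := [.ax B x y, k]) (R := R)
      (by rcases hcut with rfl | rfl <;> simp) (by simp [hc, hk])
    exact h.rewrites _ _ (.ax hΔ hz hcut hzf)

/-- The nodes above the two premises cannot be axioms. Unless one of them can be entered upwards,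
typing forces them to be the two sides of a redex. The tensor and `!` cases follow the same pattern.
-/
theorem up_of_cut_one (h : R.Stuck) {k : Cell Op} (hk : k ∈ R) {e f : ℕ}
    (hcut : k.IsCut .one e f) : R.Up e ∨ R.Up f := by
  obtain ⟨c, hc, he⟩ := List.mem_flatMap.1 (hcut.mem_left h.typed hk)
  obtain ⟨c', hc', hf⟩ := List.mem_flatMap.1 (hcut.mem_right h.typed hk)
  have hax := fun B x y => h.not_ax_of_cut hk hc (B := B) (x := x) (y := y) hcut he
  have hax' := fun B x y => h.not_ax_of_cut hk hc' (B := B) (x := x) (y := y) hcut.symm hf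
  cases c <;> simp [Cell.concls] at he hax
  case sync l ps =>
    obtain ⟨p, hp, rfl, _⟩ := he
    exact Or.inl ⟨_, hc, List.mem_map_of_mem hp⟩
  case botBox g ds S₀ S₁ =>
    obtain ⟨d, hd, rfl, _⟩ := he
    exact Or.inl ⟨_, hc, List.mem_map_of_mem hd⟩
  case one =>
    subst he
    cases c' <;> simp [Cell.concls, Formula.dual] at hf hax'
    case sync l ps =>
      obtain ⟨p, hp, rfl, _⟩ := hf
      exact Or.inr ⟨_, hc', List.mem_map_of_mem hp⟩
    case botBox g ds S₀ S₁ =>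
      rcases hf with rfl | ⟨d, hd, rfl, _⟩
      -- A test redex: the doors have distinct names inside and outside, so both contents can be
      -- copied.
      · exfalso
        obtain ⟨Δ, hΔ⟩ := exists_perm_append (L := [.one e, .botBox f ds S₀ S₁, k]) (R := R)
          (by rcases hcut with rfl | rfl <;> simp) (by simp [hc, hc', hk])
        obtain ⟨_, h₀, h₁⟩ := h.typed.node _ hc'
        have hn := (List.nodup_cons.1 (h.typed.conclEdges_nodup hc')).2
        rw [List.map_map] at hn
        have n₀ := (h.preNet.content hc' (S := S₀) (by simp [Cell.contents])).concls_nodup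
        have n₁ := (h.preNet.content hc' (S := S₁) (by simp [Cell.contents])).concls_nodup
        rw [(h₀.map _).nodup_iff] at n₀
        rw [(h₁.map _).nodup_iff] at n₁
        obtain ⟨S₀', hS₀⟩ := Net.exists_isCopy S₀ (ds := ds.map fun d => (d.left, d.outer)) R.edges
          (by simpa [Function.comp_def] using n₀) (by simpa [Function.comp_def] using hn)
        obtain ⟨S₁', hS₁⟩ := Net.exists_isCopy S₁ (ds := ds.map fun d => (d.right, d.outer)) R.edges
          (by simpa [Function.comp_def] using n₁) (by simpa [Function.comp_def] using hn)
        exact h.test _ _ _ (.mk hΔ hcut hS₀ hS₁)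
      · exact Or.inr ⟨_, hc', List.mem_map_of_mem hd⟩

theorem up_of_cut_tensor (h : R.Stuck) {k : Cell Op} (hk : k ∈ R) {A B : Formula} {e f : ℕ}
    (hcut : k.IsCut (.tensor A B) e f) : R.Up e ∨ R.Up f := by
  obtain ⟨c, hc, he⟩ := List.mem_flatMap.1 (hcut.mem_left h.typed hk)
  obtain ⟨c', hc', hf⟩ := List.mem_flatMap.1 (hcut.mem_right h.typed hk)
  have hax := fun B x y => h.not_ax_of_cut hk hc (B := B) (x := x) (y := y) hcut he
  have hax' := fun B x y => h.not_ax_of_cut hk hc' (B := B) (x := x) (y := y) hcut.symm hf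
  cases c <;> simp [Cell.concls] at he hax
  case sync l ps =>
    obtain ⟨p, hp, rfl, _⟩ := he
    exact Or.inl ⟨_, hc, List.mem_map_of_mem hp⟩
  case botBox g ds S₀ S₁ =>
    obtain ⟨d, hd, rfl, _⟩ := he
    exact Or.inl ⟨_, hc, List.mem_map_of_mem hd⟩
  case tensor _ _ a b _ =>
    obtain ⟨rfl, rfl, rfl⟩ := he
    cases c' <;> simp [Cell.concls, Formula.dual] at hf hax'
    case sync l ps =>
      obtain ⟨p, hp, rfl, _⟩ := hf
      exact Or.inr ⟨_, hc', List.mem_map_of_mem hp⟩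
    case botBox g ds S₀ S₁ =>
      obtain ⟨d, hd, rfl, _⟩ := hf
      exact Or.inr ⟨_, hc', List.mem_map_of_mem hd⟩
    case par _ _ a' b' _ =>
      obtain ⟨rfl, rfl, rfl⟩ := hf
      obtain ⟨Δ, hΔ⟩ := exists_perm_append (R := R)
        (L := [.tensor A B a b e, .par A.dual B.dual a' b' f, k])
        (by rcases hcut with rfl | rfl <;> simp) (by simp [hc, hc', hk])
      exact (h.rewrites _ _ (.mult hΔ hcut)).elim

theorem up_of_cut_bang (h : R.Stuck) {k : Cell Op} (hk : k ∈ R) {A : Formula} {e f : ℕ}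
    (hcut : k.IsCut (.bang A) e f) : R.Up e ∨ R.Up f := by
  obtain ⟨c, hc, he⟩ := List.mem_flatMap.1 (hcut.mem_left h.typed hk)
  obtain ⟨c', hc', hf⟩ := List.mem_flatMap.1 (hcut.mem_right h.typed hk)
  have hax := fun B x y => h.not_ax_of_cut hk hc (B := B) (x := x) (y := y) hcut he
  have hax' := fun B x y => h.not_ax_of_cut hk hc' (B := B) (x := x) (y := y) hcut.symm hf
  obtain ⟨a', b', ha', hb', hab⟩ := exists_not_mem_pair R.edges
  cases c <;> simp [Cell.concls] at he hax
  case sync l ps =>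
    obtain ⟨p, hp, rfl, _⟩ := he
    exact Or.inl ⟨_, hc, List.mem_map_of_mem hp⟩
  case botBox g ds S₀ S₁ =>
    obtain ⟨d, hd, rfl, _⟩ := he
    exact Or.inl ⟨_, hc, List.mem_map_of_mem hd⟩
  case expBox y A a e ds S =>
    obtain ⟨rfl, rfl⟩ := he
    -- A box with auxiliary doors can be entered by its principal door; the exponential rules are
    -- needed for closed boxes only.
    by_cases hds : ds = []
    swap
    · exact Or.inl ⟨_, hc, rfl, hds⟩
    subst hds
    have hperm : ∀ c₁ ∈ R, c₁ ≠ k → c₁ ≠ .expBox y A a e [] S →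
        ∃ Δ, R.Perm (.expBox y A a e [] S :: c₁ :: k :: Δ) := by
      intro c₁ h₁ hne hne'
      have hkx : k ≠ .expBox y A a e [] S := by rcases hcut with rfl | rfl <;> simp
      exact exists_perm_append (L := [_, _, k])
        (by simp [hne, hne'.symm, hkx.symm]) (by simp [hc, h₁, hk])
    have hkn : ∀ c₁ : Cell Op, (∀ B x y, c₁ ≠ .cut B x y) → c₁ ≠ k := by
      rintro c₁ h₁ rfl
      rcases hcut with rfl | rfl <;> exact h₁ _ _ _ rfl
    cases c' <;> simp [Cell.concls, Formula.dual] at hf hax'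
    case sync l ps =>
      obtain ⟨p, hp, rfl, _⟩ := hf
      exact Or.inr ⟨_, hc', List.mem_map_of_mem hp⟩
    case botBox g ds S₀ S₁ =>
      obtain ⟨d, hd, rfl, _⟩ := hf
      exact Or.inr ⟨_, hc', List.mem_map_of_mem hd⟩
    case der =>
      obtain ⟨rfl, rfl⟩ := hf
      obtain ⟨Δ, hΔ⟩ := hperm _ hc' (hkn _ (by simp)) (by simp)
      cases y with
      | none =>
        obtain ⟨S', hS'⟩ := Net.exists_isCopy S (ds := [(a, a')]) R.edges (by simp) (by simp)
        exact (h.rewrites _ _ (.der hΔ hcut ha' hS')).elim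
      | some r =>
        have har := (h.preNet.content hc (S := S) (by simp [Cell.contents])).concls_nodup
        have ht := h.typed.node _ hc
        simp only [Cell.TypedNode] at ht
        rw [(ht.map _).nodup_iff] at har
        obtain ⟨S', hS'⟩ := Net.exists_isCopy S (ds := [(a, a'), (r, b')]) R.edges
          (by simpa using har) (by simpa using hab)
        exact (h.rewrites _ _ (.fix hΔ hcut ha' hb' hS')).elim
    case weak =>
      obtain ⟨rfl, rfl⟩ := hf
      obtain ⟨Δ, hΔ⟩ := hperm _ hc' (hkn _ (by simp)) (by simp)
      exact (h.rewrites _ _ (.weak hΔ hcut)).elim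
    case contr =>
      obtain ⟨rfl, rfl⟩ := hf
      obtain ⟨Δ, hΔ⟩ := hperm _ hc' (hkn _ (by simp)) (by simp)
      exact (h.rewrites _ _ (.contr hΔ hcut ha' hb' hab)).elim
    case expBox y' B b g ds T =>
      obtain ⟨d, hd, rfl, hdA⟩ := hf
      obtain ⟨ds₁, ds₂, rfl⟩ := List.append_of_mem hd
      obtain ⟨Δ, hΔ⟩ := hperm _ hc' (hkn _ (by simp)) (by simp)
      obtain ⟨e', _, he', _⟩ := exists_not_mem_pair (Net.edges T)
      exact (h.rewrites _ _ (.enter hΔ hdA hcut he')).elim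

/-- Read from its other premise, a cut on a negative formula is a cut on a positive connective, so
the three preceding cases suffice. -/
theorem up_of_cut (h : R.Stuck) {k : Cell Op} (hk : k ∈ R) {A : Formula} {e f : ℕ}
    (hcut : k.IsCut A e f) : R.Up e ∨ R.Up f := by
  have hs := hcut.symm
  cases A with
  | one => exact h.up_of_cut_one hk hcut
  | tensor => exact h.up_of_cut_tensor hk hcut
  | bang => exact h.up_of_cut_bang hk hcut
  | bot => exact (h.up_of_cut_one hk hs).symm
  | par => exact (h.up_of_cut_tensor hk hs).symm
  | quest => exact (h.up_of_cut_bang hk hs).symm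

/-! ### Continuing the walk -/

/-- If `w` is cut, one of the two premises can be followed upwards, and it is not `w`, because its
only source is `c`. -/
theorem down_of_not_upPort (h : R.Stuck) {c : Cell Op} (hc : c ∈ R) {w : ℕ} {T : Formula}
    (hw : (w, T) ∈ c.concls) (hT : ¬ T.NoBotExp) (hn : ¬ c.UpPort w) : R.Down w :=
  ⟨T, List.mem_flatMap.2 ⟨c, hc, hw⟩, hT, fun _ hk _ _ hcut =>
    (h.up_of_cut hk hcut).resolve_left
      (h.not_up hc (List.mem_map_of_mem (f := Prod.fst) hw) hn)⟩

/-- The condition on cuts holds vacuously: a conclusion of an axiom is never cut in a stuck net. -/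
theorem down_of_isAx (h : R.Stuck) {c : Cell Op} (hc : c ∈ R) {A : Formula} {w w' : ℕ}
    (hax : c.IsAx A w w') (hA : A.IsPositive) : R.Down w' := by
  have hw : (w', A.dual) ∈ c.concls := by
    rcases hax with rfl | rfl <;> simp [Cell.concls]
  refine ⟨A.dual, List.mem_flatMap.2 ⟨c, hc, hw⟩, hA.not_noBotExp_dual, ?_⟩
  intro k hk B f hcut
  have hB := h.typed.type_unique (hcut.mem_left h.typed hk) (List.mem_flatMap.2 ⟨c, hc, hw⟩)
  subst hB
  rcases hax with hax | hax <;> exact (h.not_ax_of_cut hk hc hcut hw hax).elim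

/-- A premise of a sync node of a stuck net that is not the conclusion of a `one` node can be
followed upwards. -/
theorem up_of_sync (h : R.Stuck) {l : Op} {ps : List SyncPort} (hc : .sync l ps ∈ R)
    {q : SyncPort} (hq : q ∈ ps) (hone : .one q.prem ∉ R) : R.Up q.prem := by
  have hpos : q.ty.IsPositive := h.typed.node _ hc q hq
  have hq' : (q.prem, q.ty) ∈ R.flatMap Cell.concls :=
    h.typed.prem_concl _ (List.mem_flatMap.2 ⟨_, hc, List.mem_map_of_mem hq⟩)
  obtain ⟨c, hcR, hcq⟩ := List.mem_flatMap.1 hq'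
  cases c
  case ax A e f =>
    refine ⟨_, hcR, ?_⟩
    simp [Cell.concls] at hcq
    rcases hcq with ⟨h₁, h₂⟩ | ⟨h₁, h₂⟩
    · exact Or.inl ⟨h₁, h₂ ▸ hpos⟩
    · exact Or.inr ⟨h₁, h₂ ▸ hpos⟩
  case one e =>
    simp [Cell.concls] at hcq
    exact (hone (hcq.1 ▸ hcR)).elim
  case tensor A B a b g =>
    simp [Cell.concls] at hcq
    obtain ⟨T, e, f⟩ := q
    obtain ⟨rfl, rfl⟩ := hcq
    obtain ⟨a', b', ha', hb', hab⟩ := exists_not_mem_pair R.edges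
    obtain ⟨ps₁, ps₂, rfl⟩ := List.append_of_mem hq
    obtain ⟨Δ, hΔ⟩ := exists_perm_append (R := R)
      (L := [.sync l (ps₁ ++ ⟨.tensor A B, e, f⟩ :: ps₂), .tensor A B a b e])
      (by simp) (by simp [hc, hcR])
    -- The `⊗` node would commute with the sync node.
    exact (h.rewrites _ _ (.syncTensor hΔ ha' hb' hab)).elim
  case sync l' ps' =>
    simp [Cell.concls] at hcq
    obtain ⟨p, hp, h₁, _⟩ := hcq
    exact ⟨_, hcR, List.mem_map.2 ⟨p, hp, h₁⟩⟩
  case botBox g ds S₀ S₁ =>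
    simp [Cell.concls] at hcq
    rcases hcq with ⟨_, h₂⟩ | ⟨d, hd, h₁, _⟩
    · rw [h₂] at hpos
      exact hpos.elim
    · exact ⟨_, hcR, List.mem_map.2 ⟨d, hd, h₁⟩⟩
  case expBox =>
    simp [Cell.concls] at hcq
    rcases hcq with ⟨_, h₂⟩ | ⟨d, hd, _, h₂⟩
    · rw [h₂] at hpos
      exact hpos.elim
    · rw [← h₂] at hpos
      exact hpos.elim
  all_goals
    simp [Cell.concls] at hcq
    try
      rw [hcq.2] at hpos
      exact hpos.elim

/-- Some premise of a sync node of a stuck net is not the conclusion of a `one` node. -/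
theorem exists_sync_premise (h : R.Stuck) {l : Op} {ps : List SyncPort} (hc : .sync l ps ∈ R) :
    ∃ q ∈ ps, Cell.one q.prem ∉ R := by
  by_contra! hall
  -- If all premises come from `one` nodes, their types are all `1`, and the port list has the form
  -- that the sync rule requires.
  have hty : ∀ q ∈ ps, q.ty = .one := fun q hq =>
    h.typed.type_unique
      (h.typed.prem_concl _ (List.mem_flatMap.2 ⟨_, hc, List.mem_map_of_mem hq⟩))
      (List.mem_flatMap.2 ⟨_, hall q hq, by simp [Cell.concls]⟩)
  have hps : ps = (ps.map fun q => (q.prem, q.concl)).map fun p => ⟨.one, p.1, p.2⟩ := by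
    rw [List.map_map]
    conv_lhs => rw [← List.map_id ps]
    exact List.map_congr_left fun q hq => by simp [← hty q hq]
  have hn := h.typed.premEdges_nodup hc
  have hn' : ((ps.map fun q => (q.prem, q.concl)).map fun p => (Cell.one p.1 : Cell Op)).Nodup := by
    simp only [Cell.premEdges, Cell.prems, List.map_map] at hn ⊢
    have := hn.map (f := fun x => (Cell.one x : Cell Op)) fun x y hxy => by injection hxy
    rwa [List.map_map] at this
  obtain ⟨Δ, hΔ⟩ := exists_perm_append (R := R)
    (L := .sync l ps :: (ps.map fun q => (q.prem, q.concl)).map fun p => Cell.one p.1)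
    (List.nodup_cons.2 ⟨by simp, hn'⟩) (by
      rintro x hx
      rcases List.mem_cons.1 hx with rfl | hx
      · exact hc
      · simp only [List.map_map, List.mem_map, Function.comp_def] at hx
        obtain ⟨q, hq, rfl⟩ := hx
        exact hall q hq)
  generalize (ps.map fun q => (q.prem, q.concl)) = ps' at hps hΔ
  subst hps
  exact h.sync _ _ _ (.mk hΔ)

/-- An axiom is left by its other conclusion, a sync node by a premise not coming from a `one` node,
a `⊥`-box by its principal conclusion, and an exponential box by an auxiliary one. The last two have
types `⊥` and `?A`, as a descent requires. -/
theorem step_up (h : R.Stuck) {w : ℕ} (hw : R.Up w) :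
    ∃ w' d', cond d' (R.Down w') (R.Up w') ∧ ∃ c ∈ R, w ∈ c.side false ∧ w' ∈ c.side (!d') ∧
      (c.IsParOrContr → d' = true) ∧ (c.IsSync → d' = false) ∧ (w' = w → d' = false) := by
  obtain ⟨c, hc, hu⟩ := hw
  have hn := h.typed.conclEdges_nodup hc
  have hwc : w ∈ c.side false := hu.mem
  cases c <;> simp only [Cell.UpPort] at hu
  case ax A e f =>
    have hef : e ≠ f := by simpa [Cell.conclEdges, Cell.concls] using hn
    rcases hu with ⟨rfl, hA⟩ | ⟨rfl, hA⟩
    · exact ⟨f, true, h.down_of_isAx hc (Or.inl rfl) hA, _, hc, hwc,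
        by simp [Cell.side, Cell.conclEdges, Cell.concls], fun _ => rfl, fun h => h.elim,
        fun h => (hef h.symm).elim⟩
    · exact ⟨e, true, h.down_of_isAx hc (A := A.dual) (w := w)
          (Or.inr (by rw [Formula.dual_dual])) hA, _, hc, hwc,
        by simp [Cell.side, Cell.conclEdges, Cell.concls], fun _ => rfl, fun h => h.elim,
        fun h => (hef h).elim⟩
  case sync l ps =>
    obtain ⟨q, hq, hone⟩ := h.exists_sync_premise hc
    refine ⟨q.prem, false, h.up_of_sync hc hq hone, _, hc, hwc, ?_, fun h => h.elim,
      fun _ => rfl, fun _ => rfl⟩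
    simp only [Cell.side, Cell.premEdges, Cell.prems, List.map_map, Function.comp_def, Bool.not_false]
    exact List.mem_map_of_mem hq
  case botBox e ds S₀ S₁ =>
    simp only [Cell.conclEdges, Cell.concls, List.map_cons, List.map_map, List.nodup_cons,
      Function.comp_def] at hn
    refine ⟨e, true, h.down_of_not_upPort hc (T := .bot) (by simp [Cell.concls]) id hn.1, _, hc,
      hwc, by simp [Cell.side, Cell.conclEdges, Cell.concls], fun _ => rfl, fun h => h.elim, ?_⟩
    rintro rfl
    exact (hn.1 hu).elim
  case expBox y A a e ds S =>
    obtain ⟨rfl, hds⟩ := hu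
    obtain ⟨d, hd⟩ := List.exists_mem_of_ne_nil _ hds
    simp only [Cell.conclEdges, Cell.concls, List.map_cons, List.map_map, List.nodup_cons,
      Function.comp_def] at hn
    have hne : d.outer ≠ w := fun h => hn.1 (h ▸ List.mem_map_of_mem hd)
    have hmem : (d.outer, d.ty.quest) ∈ (Cell.expBox y A a w ds S).concls :=
      List.mem_cons_of_mem _ (List.mem_map_of_mem hd)
    exact ⟨d.outer, true, h.down_of_not_upPort hc hmem id (fun h => hne h.1), _, hc, hwc,
      List.mem_map_of_mem hmem, fun _ => rfl, fun h => h.elim, fun h => (hne h).elim⟩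

/-- The type of `w` rules out that `w` is a conclusion of the net. Below a logical node the
offending symbol persists, or a `?` is present; at a cut, the invariant carried by `Net.Down`
supplies the ascent. -/
theorem step_down (h : R.Stuck) (hconcl : ∀ x ∈ R.concls, x.2.NoBotExp) {w : ℕ} (hw : R.Down w) :
    ∃ w' d', cond d' (R.Down w') (R.Up w') ∧ ∃ c ∈ R, w ∈ c.side true ∧ w' ∈ c.side (!d') ∧
      (c.IsParOrContr → d' = true) ∧ (c.IsSync → d' = false) ∧ (w' = w → d' = true) := by
  obtain ⟨T, hwT, hT, hcut⟩ := hw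
  have hp : w ∈ R.premEdges := by
    by_contra hp
    exact hT (hconcl (w, T) (List.mem_filter.2 ⟨hwT, by simpa using hp⟩))
  obtain ⟨c, hc, hwc⟩ := List.mem_flatMap.1 hp
  obtain ⟨⟨w, T'⟩, hT', rfl⟩ := List.mem_map.1 hwc
  dsimp only at *
  have := h.typed.type_unique (h.typed.prem_concl _ (List.mem_flatMap.2 ⟨c, hc, hT'⟩)) hwT
  subst this
  have down : ∀ g U, c.concls = [(g, U)] → (¬ T'.NoBotExp → ¬ U.NoBotExp) → ¬ c.UpPort g →
      ¬ c.IsSync → ∃ w' d', cond d' (R.Down w') (R.Up w') ∧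
        ∃ c ∈ R, w ∈ c.side true ∧ w' ∈ c.side (!d') ∧
        (c.IsParOrContr → d' = true) ∧ (c.IsSync → d' = false) ∧ (w' = w → d' = true) :=
    fun g U hg hU hup hs => ⟨g, true, h.down_of_not_upPort hc (by simp [hg]) (hU hT) hup, c, hc,
      hwc, by simp [Cell.side, Cell.conclEdges, hg], fun _ => rfl, fun h => (hs h).elim,
      fun _ => rfl⟩
  cases c <;> simp [Cell.prems] at hT'
  case cut A e f =>
    obtain ⟨w', hw', hw'p⟩ : ∃ w', (Cell.cut A e f : Cell Op).IsCut T' w w' ∧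
        w' ∈ (Cell.cut A e f : Cell Op).premEdges := by
      rcases hT' with ⟨rfl, rfl⟩ | ⟨rfl, rfl⟩
      · exact ⟨f, Or.inl rfl, by simp [Cell.premEdges, Cell.prems]⟩
      · exact ⟨e, Or.inr (by rw [Formula.dual_dual]), by simp [Cell.premEdges, Cell.prems]⟩
    exact ⟨w', false, hcut _ hc _ _ hw', _, hc, hwc, hw'p, fun h => h.elim, fun h => h.elim,
      fun he => (hw'.ne h.typed hc he.symm).elim⟩
  case tensor =>
    refine down _ _ rfl (fun hn hU => hn ?_) id id
    rcases hT' with ⟨_, rfl⟩ | ⟨_, rfl⟩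
    exacts [hU.1, hU.2]
  case par =>
    refine down _ _ rfl (fun hn hU => hn ?_) id id
    rcases hT' with ⟨_, rfl⟩ | ⟨_, rfl⟩
    exacts [hU.1, hU.2]
  case der => exact down _ _ rfl (fun _ => id) id id
  case contr => exact down _ _ rfl (fun _ => id) id id
  case sync l ps =>
    obtain ⟨q, hq, _, rfl⟩ := hT'
    -- Premises of sync nodes are positive, so the walk never descends into one.
    exact (hT (h.typed.node _ hc q hq).noBotExp).elim

theorem not_walk (h : R.Stuck) (hconcl : ∀ x ∈ R.concls, x.2.NoBotExp) (w : ℕ) (d : Bool) :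
    ¬ cond d (R.Down w) (R.Up w) := by
  refine h.acyclic.no_walk h.typed (P := fun w d => cond d (R.Down w) (R.Up w)) ?_ w d
  rintro w (_ | _) hw
  · exact h.step_up hw
  · exact h.step_down hconcl hw

theorem not_hasCut (h : R.Stuck) (hconcl : ∀ x ∈ R.concls, x.2.NoBotExp) : ¬ R.HasCut := by
  have hcut : ∀ k ∈ R, ∀ A e f, ¬ k.IsCut A e f := fun k hk A e f hkc =>
    (h.up_of_cut hk hkc).elim (h.not_walk hconcl e false) (h.not_walk hconcl f false)
  -- Without surface cuts, containing `⊥`, `!` or `?` is already enough for an edge to be followed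
  -- downwards.
  have hdown : ∀ w T, (w, T) ∈ R.flatMap Cell.concls → T.NoBotExp := fun w T hw => by
    by_contra hT
    exact h.not_walk hconcl w true ⟨T, hw, hT, fun k hk A f hkc => (hcut k hk A w f hkc).elim⟩
  intro hR
  cases hR with
  | surface hk => exact hcut _ hk _ _ _ (Or.inl rfl)
  | @inside _ c S hc hS _ =>
    cases c <;> simp [Cell.contents] at hS
    case botBox e ds S₀ S₁ =>
      exact hdown e .bot (List.mem_flatMap.2 ⟨_, hc, by simp [Cell.concls]⟩)
    case expBox y A a e ds T =>
      exact hdown e (.bang A) (List.mem_flatMap.2 ⟨_, hc, by simp [Cell.concls]⟩)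

end Net.Stuck

/-! ### Addresses and memory: irreducible program nets are stuck -/

section Reduction

variable {I : Type u} {Mem : Type v} {Op : Type w} [MulAction (FinPerm I) Mem]

theorem MemoryStructure.supp_finite (M : MemoryStructure I Mem Op) (m : Mem) :
    (supp I m).Finite := by
  obtain ⟨A, hA, hs⟩ := M.nominal m
  exact hA.subset (Set.sInter_subset_of_mem ⟨hA, hs⟩)

theorem Net.botOccs_eq_empty {R : Net Op} (hconcl : ∀ x ∈ R.concls, x.2.NoBotExp) :
    R.botOccs = ∅ := by
  refine Set.eq_empty_of_forall_notMem ?_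
  rintro x ⟨A, hA, hx⟩
  exact (hconcl _ hA).subAt_ne_bot _ hx

theorem Net.finite_ones (R : Net Op) : {e | Cell.one e ∈ R}.Finite :=
  (List.finite_toSet R).preimage (f := Cell.one) fun x _ y _ h => by injection h

/-- There is an address fresh for `ind` and for the memory. -/
theorem Config.IsRawProgramNet.exists_fresh {M : MemoryStructure I Mem Op} {r : Config I Mem Op}
    (hr : r.IsRawProgramNet M) (hconcl : ∀ x ∈ r.net.concls, x.2.NoBotExp) :
    ∃ i, (∀ x, r.ind x ≠ some i) ∧ i ∉ supp I r.mem := by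
  -- No `⊥` occurs in the conclusions, so `ind` is defined at most on the finitely many surface
  -- `one` nodes.
  have hin : r.net.inputs.Finite := by
    refine (r.net.finite_ones.image fun e => ((e, []) : Occ)).subset ?_
    rintro ⟨e, p⟩ hx
    rw [Net.inputs, Net.botOccs_eq_empty hconcl, Set.union_empty] at hx
    obtain ⟨he, hp⟩ := hx
    exact ⟨e, he, by rw [show p = [] from hp]⟩
  have hfin : (some ⁻¹' (r.ind '' r.net.inputs) : Set I).Finite :=
    (hin.image r.ind).preimage (Option.some_injective I).injOn
  have := M.infinite_addr
  obtain ⟨i, hi⟩ := (hfin.union (M.supp_finite r.mem)).exists_notMem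
  rw [Set.mem_union, not_or] at hi
  exact ⟨i, fun x hx => hi.1 ⟨x, hr.ind_dom x i hx, hx⟩, hi.2⟩

/-- Since linking is impossible, all surface `one` nodes are active; the side conditions of the test
and sync rules therefore always hold. -/
theorem Config.IsRawProgramNet.stuck {M : MemoryStructure I Mem Op} {r : Config I Mem Op}
    (hr : r.IsRawProgramNet M) (hconcl : ∀ x ∈ r.net.concls, x.2.NoBotExp)
    (hn : ∀ ν, ¬ RawStep M r ν) : r.net.Stuck := by
  have hact : ∀ e, Cell.one e ∈ r.net → ∃ i, r.ind (e, []) = some i := by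
    intro e he
    by_contra hnone
    have hnone : r.ind (e, []) = none := by
      rw [Option.eq_none_iff_forall_ne_some]
      exact fun i hi => hnone ⟨i, hi⟩
    obtain ⟨i, hi, him⟩ := hr.exists_fresh hconcl
    exact hn _ (.link he hnone hi him)
  refine ⟨hr.preNet, hr.correct.here, fun mv R' h => hn _ (.net h), ?_, ?_⟩
  · intro e R₀ R₁ h
    have he : Cell.one e ∈ r.net := by
      cases h with
      | mk hR => exact hR.mem_iff.2 (by simp)
    obtain ⟨i, hi⟩ := hact e he
    exact hn _ (.test h hi)
  · intro l ps R' h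
    have hmem : ∀ c ∈ Cell.sync l (ps.map fun p => ⟨.one, p.1, p.2⟩) ::
        ps.map (fun p => Cell.one p.1), c ∈ r.net := by
      cases h with
      | mk hR => exact fun c hc => hR.mem_iff.2 (List.mem_append_left _ hc)
    have hs := hmem _ List.mem_cons_self
    have hones : ∀ p ∈ ps, ∃ i, r.ind (p.1, []) = some i := fun p hp =>
      hact p.1 (hmem _ (List.mem_cons_of_mem _ (List.mem_map_of_mem hp)))
    obtain ⟨is, his⟩ : ∃ is : List I, (ps.map fun p => r.ind (p.1, [])) = is.map some := by
      clear h hmem hs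
      induction ps with
      | nil => exact ⟨[], rfl⟩
      | cons p ps ih =>
        obtain ⟨is, his⟩ := ih fun q hq => hones q (List.mem_cons_of_mem _ hq)
        obtain ⟨i, hi⟩ := hones p List.mem_cons_self
        exact ⟨i :: is, by simp [hi, his]⟩
    have hlen : is.length = ps.length := by simpa using congrArg List.length his.symm
    have harity : M.arity l = is.length := by
      rw [← hr.arity.here l _ hs, hlen]
      simp [Function.comp_def, Formula.countOne]
    -- Distinct premises have distinct addresses by injectivity of `ind`; together with the arity
    -- condition this makes `update` defined.
    have hnd : is.Nodup := by
      have hp := hr.preNet.here.premEdges_nodup hs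
      simp only [Cell.premEdges, Cell.prems, List.map_map, Function.comp_def] at hp
      refine List.Nodup.of_map some ?_
      rw [← his]
      refine (List.nodup_map_iff_inj_on (List.Nodup.of_map _ hp)).2 fun p hp' q hq' hpq => ?_
      obtain ⟨i, hi⟩ := hones p hp'
      have hpq' := hr.ind_inj _ _ i hi (hpq ▸ hi)
      exact List.inj_on_of_nodup_map hp hp' hq' (Prod.ext_iff.1 hpq').1
    obtain ⟨m', hm'⟩ := Option.isSome_iff_exists.1 ((M.update_defined is l r.mem).2 ⟨hnd, harity⟩)
    exact hn _ (.update h his hm')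

end Reduction

end SMEYLL

theorem mainTheorem7 {I : Type*} {Mem : Type*} {Op : Type*} [MulAction (SMEYLL.FinPerm I) Mem]
    (M : SMEYLL.MemoryStructure I Mem Op) (r : SMEYLL.Config I Mem Op)
    (hr : r.IsRawProgramNet M)
    (hconcl : ∀ x ∈ r.net.concls, x.2.NoBotExp) :
    (r.net.HasCut → ∃ μ, SMEYLL.Step M r.toClass μ) ∧
      (SMEYLL.IsNormal M r.toClass → ¬ r.net.HasCut) := by
  -- A raw step from the representative `r` itself already gives a step of its class, so `r` admits
  -- none.
  have key : SMEYLL.IsNormal M r.toClass → ¬ r.net.HasCut := fun hn =>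
    (hr.stuck hconcl fun ν hν => hn ⟨_, r, ν, rfl, hν, rfl⟩).not_hasCut hconcl
  exact ⟨fun hc => not_not.1 fun hn => key hn hc, key⟩
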